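/- Let $q$ be an odd prime power, let $m\equiv 2\pmod 4$ with $m\ge 6$, and let $n=q^m+1$. For $0\le s\le n-1$ let $C_s=\{sq^i \bmod n : 0\le i\le l-1\}\subseteq\{0,1,\dots,n-1\}$, where $l$ is the multiplicative order of $q$ modulo $n$, be the $q$-cyclotomic coset of $s$ modulo $n$; the smallest element of $C_s$ is called the coset leader of $C_s$, and the coset leaders modulo $n$ are the numbers $\min C_s$ for $0\le s\le n-1$. Put $$\delta_3=\frac{(q-1)^2\,(q^m-2q^{m-4}-1)}{2(q^2+1)},\qquad \delta_4=\begin{cases}\delta_3-q(q-1)^2, & m=6,\\ \delta_3-(q-1)^2(q^2-1), & m>6.\end{cases}$$ Then $\delta_3$ and $\delta_4$ are nonnegative integers, $\delta_3$ is the third largest and $\delta_4$ the fourth largest coset leader modulo $n$, and $|C_{\delta_3}|=|C_{\delta_4}|=2m$. -/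

import Mathlib

/-- The `q`-cyclotomic coset modulo `n` of representative `s`: the residues `s * q ^ i mod n` in
`{0, …, n - 1}`, for `0 ≤ i < l` with `l` the multiplicative order of `q` modulo `n`. -/
noncomputable def cyclotomicCoset (q n s : ℕ) : Finset ℕ :=
  (Finset.range (orderOf (q : ZMod n))).image fun i => s * q ^ i % n

/-- The coset leader of the `q`-cyclotomic coset of `s` modulo `n`: its smallest element
(the coset is nonempty as soon as `q` is coprime to `n ≥ 1`). -/
noncomputable def cosetLeader (q n s : ℕ) : ℕ :=
  sInf (cyclotomicCoset q n s : Set ℕ)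

/-- The set of all coset leaders modulo `n`. -/
noncomputable def minRep (q n : ℕ) : Finset ℕ :=
  (Finset.range n).image (cosetLeader q n)

/-- `a` is the `i`-th largest element of the finite set `S` (counting from `i = 1`): it belongs to
`S`, and exactly `i - 1` elements of `S` are larger. -/
def IsNthLargest (S : Finset ℕ) (i a : ℕ) : Prop :=
  a ∈ S ∧ (S.filter fun b => a < b).card + 1 = i

/-! Write n = q^m + 1 = 2h = (q² + 1)N. Since q is odd, q^t h ≡ h mod n, and q^m ≡ -1. Hence s > 0
is a coset leader exactly when M = h - s ≥ 0 bounds the least absolute residues of all q^t M, and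
the largest leaders come from the smallest orbit maxima M. These are 0, then qN with orbit qN, -N,
-qN, N, then qN + E₃ and qN + E₄.

To exclude other values, follow the orbit of M = qN + E through the points whose successor needs a
subtraction of n. Up to sign these are qN + e, and the next one comes after a gap of one or two
multiplications, with new deviation -qe - (q-1)N or -q²e (`Deviation.step`). If E < 0, all gaps are
1 and M = n/(q+1), which is not an integer. If E > 0, the gaps begin 2, 1, 1 and lead to the
deviation F = (q-1)²N - q⁴E. A positive F would keep returning to positive deviations, against q^m ≡
-1. A negative F is multiplied by q⁴ in each block 2, 2, and for E₃ < E < E₄ this run goes on until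
it breaks the lower bound (`Deviation.eq_of_pos`). For m = 6 the bounds on the first few deviations
suffice (`Deviation.eq_of_pos_six`).

Conversely, explicit orbits (`third_orbit`, `fourth_orbit`, `fourth_orbit_six`) show that qN + E₃
and qN + E₄ strictly dominate their orbits for 0 < t < m, which gives both the leaders and the coset
size 2m. -/

/-! ### Bounded orbits and deviations -/

/-- Every `q ^ i * z` lies within distance `M` of a multiple of `n`. -/
def OrbitBounded (q n M z : ℤ) : Prop :=
  ∀ i : ℕ, ∃ k : ℤ, |q ^ i * z - k * n| ≤ M

theorem OrbitBounded.neg {q n M z : ℤ} (h : OrbitBounded q n M z) : OrbitBounded q n M (-z) := by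
  intro i
  obtain ⟨k, hk⟩ := h i
  refine ⟨-k, ?_⟩
  rw [← abs_neg]
  convert hk using 2
  ring

theorem OrbitBounded.mul_sub {q n M z : ℤ} (h : OrbitBounded q n M z) (k : ℤ) :
    OrbitBounded q n M (q * z - k * n) := by
  intro i
  obtain ⟨l, hl⟩ := h (i + 1)
  refine ⟨l - q ^ i * k, ?_⟩
  convert hl using 2
  ring

theorem OrbitBounded.exists_step {q n M z : ℤ} (h : OrbitBounded q n M z) :
    ∃ k : ℤ, |q * z - k * n| ≤ M ∧ OrbitBounded q n M (q * z - k * n) := by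
  obtain ⟨k, hk⟩ := h 1
  rw [pow_one] at hk
  exact ⟨k, hk, h.mul_sub k⟩

/-- The point `q * N + e` has an orbit bounded by `M = q * N + E` modulo `n = (q ^ 2 + 1) * N`, and
its successor is obtained by subtracting `n` exactly once; `e` is its deviation from the orbit of
`q * N`. -/
structure Deviation (q N E e : ℤ) : Prop where
  orbit : OrbitBounded q ((q ^ 2 + 1) * N) (q * N + E) (q * N + e)
  abs_le : |q * N + e| ≤ q * N + E
  abs_succ_le : |q * e - N| ≤ q * N + E

namespace Deviation

variable {q N E e : ℤ}

theorem le (h : Deviation q N E e) : e ≤ E := by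
  have := (_root_.abs_le.mp h.abs_le).2
  linarith

theorem lower (h : Deviation q N E e) : -((q - 1) * N) - E ≤ q * e := by
  have := (_root_.abs_le.mp h.abs_succ_le).1
  linarith

end Deviation

theorem lt_of_gap_bound {q N E : ℤ} (hq : 3 ≤ q) (hN : 0 < N)
    (hE : (q ^ 3 + 1) * E < (q ^ 2 - q) * N) : E < N ∧ q ^ 2 * E < q * N ∧ (q + 1) * E < q * N := by
  rcases le_or_gt E 0 with h | h
  · have h1 : 0 < q * N := by positivity
    have h2 : q ^ 2 * E ≤ 0 := mul_nonpos_of_nonneg_of_nonpos (by positivity) h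
    have h3 : (q + 1) * E ≤ 0 := mul_nonpos_of_nonneg_of_nonpos (by linarith) h
    exact ⟨by linarith, by linarith, by linarith⟩
  · have h1 : q * (q ^ 2 * E) < q * (q * N) := by nlinarith [mul_pos (by linarith : 0 < q) hN]
    have h2 : q ^ 2 * E < q * N := lt_of_mul_lt_mul_left h1 (by linarith)
    have h3 : q * (q * E) < q * N := by linarith
    have h4 : q * E < N := lt_of_mul_lt_mul_left h3 (by linarith)
    refine ⟨by nlinarith, h2, ?_⟩
    have : (q + 1) * E ≤ q ^ 2 * E := mul_le_mul_of_nonneg_right (by nlinarith) h.le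
    linarith

theorem two_mul_modulus_gt {q N E : ℤ} (hq : 3 ≤ q) (hN : 0 < N)
    (hE : (q ^ 3 + 1) * E < (q ^ 2 - q) * N) : (q + 1) * (q * N + E) < 2 * ((q ^ 2 + 1) * N) := by
  obtain ⟨-, -, h⟩ := lt_of_gap_bound hq hN hE
  nlinarith [mul_nonneg (by nlinarith : 0 ≤ q * (q - 2)) hN.le]

theorem quotient_lt_two {q n M z k : ℤ} (hq : 3 ≤ q) (hn : 0 < n) (hM : (q + 1) * M < 2 * n)
    (hz : z ≤ M) (hk : -M ≤ q * z - k * n) : k ≤ 1 := by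
  by_contra! h
  have h1 : 2 * n ≤ k * n := mul_le_mul_of_nonneg_right (by omega) hn.le
  have h2 : q * z ≤ q * M := mul_le_mul_of_nonneg_left hz (by linarith)
  linarith

/-- The quotient subtracted from q(qe - N) can only be 0 (gap 2) or -1 (gap 1). A change of sign
brings the point back to the form qN + e'. -/
theorem Deviation.step {q N E e : ℤ} (hq : 3 ≤ q) (hN : 0 < N)
    (hE : (q ^ 3 + 1) * E < (q ^ 2 - q) * N) (h : Deviation q N E e) :
    Deviation q N E (-q ^ 2 * e) ∨ Deviation q N E (-q * e - (q - 1) * N) := by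
  obtain ⟨hEN, hE2, hE1⟩ := lt_of_gap_bound hq hN hE
  have hM := two_mul_modulus_gt hq hN hE
  have hn : 0 < (q ^ 2 + 1) * N := by positivity
  have heE := h.le
  have hgood : OrbitBounded q ((q ^ 2 + 1) * N) (q * N + E) (q * e - N) := by
    convert h.orbit.mul_sub 1 using 1
    ring
  have habs := _root_.abs_le.mp h.abs_succ_le
  obtain ⟨k, hk, hkg⟩ := hgood.exists_step
  have hk' := _root_.abs_le.mp hk
  have hk1 : -k ≤ 1 := by
    refine quotient_lt_two (z := -(q * e - N)) hq hn hM (by linarith) ?_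
    linarith
  have hk0 : k ≤ 0 := by
    by_contra! hpos
    have h1 : 1 * ((q ^ 2 + 1) * N) ≤ k * ((q ^ 2 + 1) * N) :=
      mul_le_mul_of_nonneg_right (by omega) hn.le
    have h2 : q ^ 2 * e ≤ q ^ 2 * E := mul_le_mul_of_nonneg_left heE (by positivity)
    have h3 : (q ^ 2 + 1) * E < (q ^ 2 + 1) * N := mul_lt_mul_of_pos_left hEN (by positivity)
    linarith
  obtain rfl | rfl : k = 0 ∨ k = -1 := by omega
  · left
    have hg : OrbitBounded q ((q ^ 2 + 1) * N) (q * N + E) (q * N + -q ^ 2 * e) := by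
      convert hkg.neg using 1
      ring
    have ha : |q * N + -q ^ 2 * e| ≤ q * N + E := by
      rw [← abs_neg]
      convert hk using 2
      ring
    refine ⟨hg, ha, ?_⟩
    obtain ⟨l, hl, -⟩ := hg.exists_step
    have hl' := _root_.abs_le.mp hl
    have hl1 : l ≤ 1 := quotient_lt_two hq hn hM (_root_.abs_le.mp ha).2 hl'.1
    -- A quotient at most 0 would give q²N - q³e ≤ qN + E, against the bound (q³ + 1)E < (q² - q)N.
    have hl0 : 1 ≤ l := by
      by_contra! hneg
      have h1 : l * ((q ^ 2 + 1) * N) ≤ 0 :=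
        mul_nonpos_of_nonpos_of_nonneg (by omega) hn.le
      have h2 : q ^ 3 * e ≤ q ^ 3 * E := mul_le_mul_of_nonneg_left heE (by positivity)
      linarith
    obtain rfl : l = 1 := by omega
    convert hl using 2
    ring
  · right
    refine ⟨?_, ?_, ?_⟩
    · convert hgood.neg using 1
      ring
    · rw [← abs_neg]
      convert h.abs_succ_le using 2
      ring
    · rw [← abs_neg]
      convert hk using 2
      ring

theorem deviation_self {q N E : ℤ} (hq : 3 ≤ q) (hN : 0 < N)
    (hE : (q ^ 3 + 1) * E < (q ^ 2 - q) * N) (hM : 0 < q * N + E)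
    (h : OrbitBounded q ((q ^ 2 + 1) * N) (q * N + E) (q * N + E)) : Deviation q N E E := by
  have hn : 0 < (q ^ 2 + 1) * N := by positivity
  refine ⟨h, (abs_of_pos hM).le, ?_⟩
  obtain ⟨k, hk, -⟩ := h.exists_step
  have hk' := _root_.abs_le.mp hk
  have hk1 : k ≤ 1 := quotient_lt_two hq hn (two_mul_modulus_gt hq hN hE) le_rfl hk'.1
  have hk0 : 1 ≤ k := by
    by_contra! hneg
    have h1 : k * ((q ^ 2 + 1) * N) ≤ 0 := mul_nonpos_of_nonpos_of_nonneg (by omega) hn.le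
    nlinarith
  obtain rfl : k = 1 := by omega
  convert hk using 2
  ring

/-! ### Admissible words of gaps -/

/-- If the maximal deviation is negative, the orbit is that of `n / (q + 1)`. -/
theorem Deviation.eq_of_neg {q N E : ℤ} (hq : 3 ≤ q) (hN : 0 < N)
    (hE : (q ^ 3 + 1) * E < (q ^ 2 - q) * N) (hneg : E < 0) (h : Deviation q N E E) :
    (q + 1) * E = -((q - 1) * N) := by
  have hq2 : 0 < q ^ 2 := by positivity
  rcases h.step hq hN hE with h1 | h1
  · nlinarith [h1.le]
  · have hle := h1.le
    rcases h1.step hq hN hE with h2 | h2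
    · nlinarith [h2.le]
    · have h3 : (q - 1) * ((q + 1) * E) ≤ (q - 1) * -((q - 1) * N) := by linarith [h2.le]
      have h4 := le_of_mul_le_mul_left h3 (by linarith)
      linarith

theorem Deviation.step_of_pos {q N E x : ℤ} (hq : 3 ≤ q) (hN : 0 < N)
    (hE : (q ^ 3 + 1) * E < (q ^ 2 - q) * N) (hx : 0 < x) (h : Deviation q N E x) :
    Deviation q N E (-q ^ 2 * x) := by
  obtain ⟨hEN, -, -⟩ := lt_of_gap_bound hq hN hE
  refine (h.step hq hN hE).resolve_right fun h1 => ?_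
  have := h1.lower
  have h2 : 1 * N ≤ (q - 1) ^ 2 * N := mul_le_mul_of_nonneg_right (by nlinarith) hN.le
  have h3 : 0 < q ^ 2 * x := by positivity
  linarith

/-- The word 1, 2 would produce q³x + q²(q-1)N, which exceeds E by `hK` when x ≥ -q²K. So a gap 1 is
followed by another gap 1. -/
theorem Deviation.step_of_lower_bound {q N E K x : ℤ} (hq : 3 ≤ q) (hN : 0 < N)
    (hE : (q ^ 3 + 1) * E < (q ^ 2 - q) * N) (hK : q ^ 5 * K + E < q ^ 2 * (q - 1) * N)
    (hx : -(q ^ 2 * K) ≤ x) (h : Deviation q N E x) :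
    Deviation q N E (-q ^ 2 * x) ∨ Deviation q N E (q ^ 2 * x + (q - 1) ^ 2 * N) := by
  refine (h.step hq hN hE).imp_right fun h1 => ?_
  rcases h1.step hq hN hE with h2 | h2
  · have h3 : q ^ 3 * -(q ^ 2 * K) ≤ q ^ 3 * x := mul_le_mul_of_nonneg_left hx (by positivity)
    linarith [h2.le]
  · convert h2 using 1
    ring

/-- A positive deviation is followed by the gaps `2, 2` or by the gaps `2, 1, 1`. -/
theorem Deviation.return_of_pos {q N E K : ℤ} (hq : 3 ≤ q) (hN : 0 < N)
    (hE : (q ^ 3 + 1) * E < (q ^ 2 - q) * N) (hK : q ^ 5 * K + E < q ^ 2 * (q - 1) * N)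
    (hEK : E ≤ K) {x : ℤ} (hx : 0 < x) (h : Deviation q N E x) :
    Deviation q N E (q ^ 4 * x) ∨ Deviation q N E ((q - 1) ^ 2 * N - q ^ 4 * x) := by
  have h1 := h.step_of_pos hq hN hE hx
  have h2 : q ^ 2 * x ≤ q ^ 2 * K := mul_le_mul_of_nonneg_left (h.le.trans hEK) (by positivity)
  rcases h1.step_of_lower_bound hq hN hE hK (by linarith) with h3 | h3
  · left; convert h3 using 1; ring
  · right; convert h3 using 1; ring

theorem Deviation.not_pow_four_mul_self {q N E : ℤ} (hq : 3 ≤ q) (hE : 0 < E) :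
    ¬ Deviation q N E (q ^ 4 * E) := fun h => by
  have h1 : (3 : ℤ) ^ 4 ≤ q ^ 4 := pow_le_pow_left₀ (by norm_num) hq 4
  nlinarith [h.le]

/-- Starting from a positive deviation that is minimal among the returns, the deviation stays
positive at all times divisible by four. -/
theorem Deviation.pos_at_four_mul {q N E K F : ℤ} (hq : 3 ≤ q) (hN : 0 < N)
    (hE : (q ^ 3 + 1) * E < (q ^ 2 - q) * N) (hK : q ^ 5 * K + E < q ^ 2 * (q - 1) * N)
    (hEK : E ≤ K) (hF : F = (q - 1) ^ 2 * N - q ^ 4 * E) (hFpos : 0 < F)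
    (h : Deviation q N E F) (c : ℕ) :
    ∃ x s : ℤ, 0 < x ∧ Deviation q N E x ∧ (s = 1 ∨ s = -1) ∧
      (q ^ 2 + 1) * N ∣ q ^ (4 * c) * (q * N + F) - s * (q * N + x) := by
  induction c with
  | zero => exact ⟨F, 1, hFpos, h, Or.inl rfl, by simp⟩
  | succ c ih =>
    obtain ⟨x, s, hx, hdx, hs, k, hk⟩ := ih
    rcases hdx.return_of_pos hq hN hE hK hEK hx with h1 | h1
    · refine ⟨q ^ 4 * x, s, by positivity, h1, hs, q ^ 4 * k + s * q * (q ^ 2 - 1), ?_⟩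
      rw [show 4 * (c + 1) = 4 * c + 4 by ring, pow_add]
      linear_combination q ^ 4 * hk
    -- Since x ≤ E, the new deviation is at least F > 0.
    · have h2 : q ^ 4 * x ≤ q ^ 4 * E := mul_le_mul_of_nonneg_left hdx.le (by positivity)
      refine ⟨_, -s, by linarith, h1, hs.symm.imp (by rintro rfl; rfl) (by rintro rfl; rfl),
        q ^ 4 * k + s * (q ^ 3 - q + 1), ?_⟩
      rw [show 4 * (c + 1) = 4 * c + 4 by ring, pow_add]
      linear_combination q ^ 4 * hk

/-- Two multiplications after time 4(j+1), the factor is q^m ≡ -1. As q³N ≡ -qN, n would divide F +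
q²x or 2qN + F - q²x, both strictly between 0 and n. -/
theorem Deviation.not_return_pos {q N E K F : ℤ} {j : ℕ} (hq : 3 ≤ q) (hN : 0 < N)
    (hn : (q ^ 2 + 1) * N = q ^ (4 * j + 6) + 1)
    (hE : (q ^ 3 + 1) * E < (q ^ 2 - q) * N) (hK : q ^ 5 * K + E < q ^ 2 * (q - 1) * N)
    (hEK : E ≤ K) (hF : F = (q - 1) ^ 2 * N - q ^ 4 * E) (h : Deviation q N E F) : F ≤ 0 := by
  by_contra! hpos
  obtain ⟨hEN, hE2, hE1⟩ := lt_of_gap_bound hq hN hE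
  obtain ⟨x, s, hx, hdx, hs, k, hk⟩ := h.pos_at_four_mul hq hN hE hK hEK hF hpos (j + 1)
  have hxE : q ^ 2 * x ≤ q ^ 2 * E := mul_le_mul_of_nonneg_left hdx.le (by positivity)
  have hFE := h.le
  have hx2 : 0 < q ^ 2 * x := by positivity
  have hn0 : 0 < (q ^ 2 + 1) * N := by positivity
  have hpow : q ^ (4 * j + 6) = q ^ (4 * (j + 1)) * q ^ 2 := by ring
  have hlt : (q ^ 2 + 1) * E < (q ^ 2 + 1) * N := mul_lt_mul_of_pos_left hEN (by positivity)
  have hqN : 1 * N ≤ (q - 1) ^ 2 * N := mul_le_mul_of_nonneg_right (by nlinarith) hN.le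
  have key : (q * N + F) + s * (q ^ 2 * x - q * N) =
      (q ^ 2 + 1) * N * (q * N + F - q ^ 2 * k - s * q) := by
    linear_combination (-q ^ 2) * hk - (q * N + F) * hn - (q * N + F) * hpow
  rcases hs with rfl | rfl
  · exact absurd (Int.le_of_dvd (by linarith) ⟨_, key⟩) (by linarith)
  · exact absurd (Int.le_of_dvd (by linarith) ⟨_, key⟩) (by linarith)

/-- At a negative deviation the alternative 1, 1 is excluded by `hexit`, so a gap 2 occurs. It makes
the deviation positive, which forces a second gap 2. The lower bound -q²K renews itself because the
intermediate deviation is at most E ≤ K. -/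
theorem Deviation.pow_four_mul_of_neg {q N E K F : ℤ} (hq : 3 ≤ q) (hN : 0 < N)
    (hE : (q ^ 3 + 1) * E < (q ^ 2 - q) * N) (hK : q ^ 5 * K + E < q ^ 2 * (q - 1) * N)
    (hEK : E ≤ K) (hF : F < 0) (hFK : -(q ^ 2 * K) ≤ F) (j : ℕ)
    (hexit : ∀ b < j, E < q ^ 2 * (q ^ (4 * b) * F) + (q - 1) ^ 2 * N)
    (h : Deviation q N E F) : Deviation q N E (q ^ (4 * j) * F) := by
  suffices ∀ b ≤ j, Deviation q N E (q ^ (4 * b) * F) ∧ -(q ^ 2 * K) ≤ q ^ (4 * b) * F from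
    (this j le_rfl).1
  intro b
  induction b with
  | zero => intro; simpa using ⟨h, hFK⟩
  | succ b ih =>
    intro hb
    obtain ⟨h1, h2⟩ := ih (by omega)
    have h3 := (h1.step_of_lower_bound hq hN hE hK h2).resolve_right fun h4 =>
      absurd h4.le (hexit b (by omega)).not_ge
    have hneg : q ^ (4 * b) * F < 0 := mul_neg_of_pos_of_neg (by positivity) hF
    have hpos : 0 < -q ^ 2 * (q ^ (4 * b) * F) :=
      mul_pos_of_neg_of_neg (by have : 0 < q ^ 2 := by positivity
                                linarith) hneg
    have h5 := h3.step_of_pos hq hN hE hpos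
    have h6 : q ^ (4 * (b + 1)) * F = -q ^ 2 * (-q ^ 2 * (q ^ (4 * b) * F)) := by
      rw [show 4 * (b + 1) = 4 * b + 4 by ring, pow_add]; ring
    rw [h6]
    refine ⟨h5, ?_⟩
    have := mul_le_mul_of_nonneg_left (h3.le.trans hEK) (by positivity : 0 ≤ q ^ 2)
    linarith

/-! ### Size estimates for m ≥ 10 -/

/-- Here R stands for q^(4i) with m = 4i + 10. The crude ceiling K = (q-1)²q⁴R for E, supplied by
`lt_of_lt_fourth`, already yields both size conditions. -/
theorem maximal_deviation_bounds {q N E R : ℤ} (hq : 3 ≤ q) (hR : 1 ≤ R)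
    (hn : (q ^ 2 + 1) * N = q ^ 10 * R + 1) (hpos : 0 < E)
    (hEK : E < (q - 1) ^ 2 * (q ^ 4 * R)) :
    q ^ 5 * ((q - 1) ^ 2 * (q ^ 4 * R)) + E < q ^ 2 * (q - 1) * N ∧
      (q ^ 3 + 1) * E < (q ^ 2 - q) * N := by
  have hc : 0 < q ^ 2 + 1 := by positivity
  set K := (q - 1) ^ 2 * (q ^ 4 * R) with hKdef
  have hK : q ^ 5 * K + E < q ^ 2 * (q - 1) * N := by
    have hK1 : (q ^ 5 + 1) * K ≤ q ^ 2 * (q - 1) * N := by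
      refine le_of_mul_le_mul_left (a := q ^ 2 + 1) ?_ hc
      have h1 : q ^ 4 * R * (q - 1) * ((q ^ 2 + 1) * (q - 1) * (q ^ 5 + 1)) ≤
          q ^ 4 * R * (q - 1) * q ^ 8 := by
        refine mul_le_mul_of_nonneg_left ?_ (mul_nonneg (by positivity) (by linarith))
        -- In terms of p = q - 3 the expanded difference has nonnegative coefficients.
        obtain ⟨p, rfl⟩ : ∃ p, q = p + 3 := ⟨q - 3, by ring⟩
        have : 0 ≤ p := by linarith
        have : 0 ≤ (p + 3) ^ 8 - ((p + 3) ^ 2 + 1) * (p + 3 - 1) * ((p + 3) ^ 5 + 1) := by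
          ring_nf; positivity
        linarith
      have h2 : 0 ≤ q ^ 2 * (q - 1) := mul_nonneg (by positivity) (by linarith)
      calc (q ^ 2 + 1) * ((q ^ 5 + 1) * K)
          = q ^ 4 * R * (q - 1) * ((q ^ 2 + 1) * (q - 1) * (q ^ 5 + 1)) := by rw [hKdef]; ring
        _ ≤ q ^ 4 * R * (q - 1) * q ^ 8 := h1
        _ ≤ q ^ 2 * (q - 1) * (q ^ 10 * R + 1) := by linarith
        _ = (q ^ 2 + 1) * (q ^ 2 * (q - 1) * N) := by rw [← hn]; ring
    linarith
  refine ⟨hK, ?_⟩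
  have h1 : q * ((q ^ 3 + 1) * E) < q * ((q ^ 2 - q) * N) := by
    have h2 : (q ^ 4 + q) * E ≤ q ^ 5 * E := by
      refine mul_le_mul_of_nonneg_right ?_ hpos.le
      have h3 : 0 ≤ q ^ 4 * (q - 3) := mul_nonneg (by positivity) (by linarith)
      have h4 : q ^ 1 ≤ q ^ 4 := pow_le_pow_right₀ (by linarith) (by norm_num)
      linarith
    have h3 : q ^ 5 * E ≤ q ^ 5 * K := mul_le_mul_of_nonneg_left hEK.le (by positivity)
    linarith
  exact lt_of_mul_lt_mul_left h1 (by linarith)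

/-- A run of gaps `2` that starts at a small negative deviation cannot be left too early. -/
theorem lt_exit_deviation {q N E F R : ℤ} (hq : 3 ≤ q) (hR : 1 ≤ R)
    (hn : (q ^ 2 + 1) * N = q ^ 10 * R + 1) (hEK : E < (q - 1) ^ 2 * (q ^ 4 * R)) (hFneg : F < 0)
    (hF : -((q - 1) ^ 2 * (q ^ 2 - 1) * (q ^ 4 + 1)) + q ^ 4 ≤ F) {c : ℤ} (hcR : c ≤ R) :
    E < q ^ 2 * (c * F) + (q - 1) ^ 2 * N := by
  have hc : 0 < q ^ 2 + 1 := by positivity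
  have h1 : R * F ≤ c * F := mul_le_mul_of_nonpos_right hcR hFneg.le
  have h2 : R * (-((q - 1) ^ 2 * (q ^ 2 - 1) * (q ^ 4 + 1)) + q ^ 4) ≤ R * F :=
    mul_le_mul_of_nonneg_left hF (by linarith)
  have h3 : q ^ 2 * (R * (-((q - 1) ^ 2 * (q ^ 2 - 1) * (q ^ 4 + 1)) + q ^ 4)) ≤
      q ^ 2 * (c * F) := mul_le_mul_of_nonneg_left (h2.trans h1) (by positivity)
  refine lt_of_mul_lt_mul_left (a := q ^ 2 + 1) ?_ hc.le
  have h4 := mul_le_mul_of_nonneg_left h3 hc.le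
  have h5 := mul_lt_mul_of_pos_left hEK hc
  have h6 : (q ^ 2 + 1) * ((q - 1) ^ 2 * (q ^ 4 * R)) ≤ (q ^ 2 + 1) * (q ^ 6 * R) := by
    refine mul_le_mul_of_nonneg_left ?_ hc.le
    have : (q - 1) ^ 2 * (q ^ 4 * R) ≤ q ^ 2 * (q ^ 4 * R) :=
      mul_le_mul_of_nonneg_right (by nlinarith) (by positivity)
    linarith
  have h7 : 0 ≤ (q - 1) ^ 2 * (q ^ 2 * R + 1) := by positivity
  have h8 : (q ^ 2 + 1) * ((q - 1) ^ 2 * N) = (q - 1) ^ 2 * (q ^ 10 * R + 1) := by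
    rw [← hn]; ring
  linarith

/-- The deviation after the run is at most -q⁸R, while the lower bound keeps it above -N. But (q² +
1)q⁸R > n. -/
theorem Deviation.false_of_run {q N E F R : ℤ} (hq : 3 ≤ q) (hR : 1 ≤ R) (hEN : E < N)
    (hn : (q ^ 2 + 1) * N = q ^ 10 * R + 1)
    (hF : F ≤ -((q - 1) ^ 2 * (q ^ 2 - 1)) - q ^ 4)
    (h : Deviation q N E (q ^ 4 * R * F)) : False := by
  have hc : 0 < q ^ 2 + 1 := by positivity
  have hsq : 0 < q ^ 2 - 1 := by nlinarith
  have hlow := h.lower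
  have hub : q * (q ^ 4 * R * F) ≤ q * (q ^ 4 * R * (-((q - 1) ^ 2 * (q ^ 2 - 1)) - q ^ 4)) :=
    mul_le_mul_of_nonneg_left (mul_le_mul_of_nonneg_left hF (by positivity)) (by linarith)
  have h1 : q * (q ^ 4 * R * ((q - 1) ^ 2 * (q ^ 2 - 1) + q ^ 4)) < q * N := by linarith
  have h2 := lt_of_mul_lt_mul_left h1 (by linarith)
  have h3 := mul_lt_mul_of_pos_left h2 hc
  rw [hn] at h3
  have h4 : q ^ 4 * R * (q ^ 6 + 1) ≤
      q ^ 4 * R * ((q ^ 2 + 1) * ((q - 1) ^ 2 * (q ^ 2 - 1) + q ^ 4)) := by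
    refine mul_le_mul_of_nonneg_left ?_ (by positivity)
    have : 0 ≤ (q ^ 2 + 1) * ((q - 1) ^ 2 * (q ^ 2 - 1)) := by positivity
    have : 1 ≤ q ^ 4 := one_le_pow₀ (by linarith)
    linarith
  have h5 : 1 * 1 ≤ q ^ 4 * R := mul_le_mul (one_le_pow₀ (by linarith)) hR (by norm_num)
    (by positivity)
  linarith

/-! ### Classification of the small orbit maxima -/

/-- Classification of the maximal deviation in the generic range. -/
theorem Deviation.eq_of_pos {q N E E₃ : ℤ} {i : ℕ} (hq : 3 ≤ q)
    (hn : (q ^ 2 + 1) * N = q ^ (4 * (i + 1) + 6) + 1)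
    (hE₃ : (q ^ 2 + 1) * E₃ = (q - 1) ^ 2 * (q ^ (4 * (i + 1) + 2) + 1))
    (hEK : E < (q - 1) ^ 2 * (q ^ 4 * q ^ (4 * i)))
    (hE : E < E₃ + (q - 1) ^ 2 * (q ^ 2 - 1)) (hpos : 0 < E)
    (h : Deviation q N E E) : E = E₃ := by
  have hN : 0 < N := by
    have : 0 < (q ^ 2 + 1) * N := by rw [hn]; positivity
    exact pos_of_mul_pos_right this (by positivity)
  have hq1 : 0 < (q - 1) ^ 2 := by have : 0 < q - 1 := by linarith
                                   positivity
  have hc : 0 < q ^ 2 + 1 := by positivity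
  have hn' : (q ^ 2 + 1) * N = q ^ 10 * q ^ (4 * i) + 1 := by rw [hn]; ring
  have hE₃' : (q ^ 2 + 1) * E₃ = (q - 1) ^ 2 * (q ^ 6 * q ^ (4 * i) + 1) := by rw [hE₃]; ring
  have e3 : q ^ (4 * (i + 1)) = q ^ 4 * q ^ (4 * i) := by ring
  have hR : 1 ≤ q ^ (4 * i) := one_le_pow₀ (by linarith)
  obtain ⟨hK, hgap⟩ := maximal_deviation_bounds hq hR hn' hpos hEK
  obtain ⟨hEN, -, -⟩ := lt_of_gap_bound hq hN hgap
  obtain ⟨F, hF⟩ : ∃ F, F = (q - 1) ^ 2 * N - q ^ 4 * E := ⟨_, rfl⟩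
  have hFd : Deviation q N E F := hF ▸
    (h.return_of_pos hq hN hgap hK hEK.le hpos).resolve_left (not_pow_four_mul_self hq hpos)
  have hF0 : F ≤ 0 := hFd.not_return_pos hq hN hn hgap hK hEK.le hF
  -- For E = E₃ the value of F is -(q-1)²(q²-1). This lies strictly between -q⁴ and 0, so F ≤ 0
  -- forces E ≥ E₃.
  have hFu : F = -((q - 1) ^ 2 * (q ^ 2 - 1)) - q ^ 4 * (E - E₃) := by
    refine mul_left_cancel₀ hc.ne' ?_
    rw [hF]
    linear_combination (q - 1) ^ 2 * hn' - q ^ 4 * hE₃'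
  have hq4 : 0 < q ^ 4 := by positivity
  have hsmall : (q - 1) ^ 2 * (q ^ 2 - 1) < q ^ 4 := by
    have h1 : (q - 1) ^ 2 * (q ^ 2 - 1) ≤ q ^ 2 * (q ^ 2 - 1) :=
      mul_le_mul_of_nonneg_right (by nlinarith) (by nlinarith)
    have : 0 < q ^ 2 := by positivity
    linarith
  have hge : E₃ ≤ E := by
    by_contra! hlt
    have : q ^ 4 * 1 ≤ q ^ 4 * (E₃ - E) := mul_le_mul_of_nonneg_left (by omega) hq4.le
    linarith
  by_contra hne
  have hF1 : F ≤ -((q - 1) ^ 2 * (q ^ 2 - 1)) - q ^ 4 := by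
    have : q ^ 4 * 1 ≤ q ^ 4 * (E - E₃) := mul_le_mul_of_nonneg_left (by omega) hq4.le
    linarith
  have hFneg : F < 0 := by
    have : 0 < (q - 1) ^ 2 * (q ^ 2 - 1) := mul_pos hq1 (by nlinarith)
    linarith
  -- For E = E₄ the value of F would be -(q-1)²(q²-1)(q⁴+1); the extra q⁴ comes from E ≤ E₄ - 1.
  have hF2 : -((q - 1) ^ 2 * (q ^ 2 - 1) * (q ^ 4 + 1)) + q ^ 4 ≤ F := by
    have : q ^ 4 * (E - E₃) ≤ q ^ 4 * ((q - 1) ^ 2 * (q ^ 2 - 1) - 1) :=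
      mul_le_mul_of_nonneg_left (by omega) hq4.le
    linarith
  have hFK : -(q ^ 2 * ((q - 1) ^ 2 * (q ^ 4 * q ^ (4 * i)))) ≤ F := by
    have h1 : (q - 1) ^ 2 * ((q ^ 2 - 1) * (q ^ 4 + 1)) ≤
        (q - 1) ^ 2 * (q ^ 2 * (q ^ 4 * q ^ (4 * i))) := by
      refine mul_le_mul_of_nonneg_left ?_ hq1.le
      have : q ^ 2 * (q ^ 4 * 1) ≤ q ^ 2 * (q ^ 4 * q ^ (4 * i)) := by gcongr
      have : q ^ 2 ≤ q ^ 4 := pow_le_pow_right₀ (by linarith) (by norm_num)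
      linarith
    linarith
  have hlast := hFd.pow_four_mul_of_neg hq hN hgap hK hEK.le hFneg hFK (i + 1) fun b hb =>
    lt_exit_deviation hq hR hn' hEK hFneg hF2 (pow_le_pow_right₀ (by linarith) (by omega))
  rw [e3] at hlast
  exact hlast.false_of_run hq hR hEN hn' hF1

theorem lt_of_lt_fourth {q E E₃ : ℤ} {i : ℕ} (hq : 3 ≤ q)
    (hE₃ : (q ^ 2 + 1) * E₃ = (q - 1) ^ 2 * (q ^ (4 * (i + 1) + 2) + 1))
    (hE : E < E₃ + (q - 1) ^ 2 * (q ^ 2 - 1)) : E < (q - 1) ^ 2 * (q ^ 4 * q ^ (4 * i)) := by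
  have hc : 0 < q ^ 2 + 1 := by positivity
  have hE₃' : (q ^ 2 + 1) * E₃ = (q - 1) ^ 2 * (q ^ 6 * q ^ (4 * i) + 1) := by rw [hE₃]; ring
  have hR : 1 ≤ q ^ (4 * i) := one_le_pow₀ (by linarith)
  refine lt_of_mul_lt_mul_left (a := q ^ 2 + 1) ?_ hc.le
  have h1 := mul_lt_mul_of_pos_left hE hc
  have h2 : (q - 1) ^ 2 * (q ^ 4 * 1) ≤ (q - 1) ^ 2 * (q ^ 4 * q ^ (4 * i)) := by gcongr
  linarith

/-- Classification of the maximal deviation for `m = 6`. -/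
theorem Deviation.eq_of_pos_six {q N E : ℤ} (hq : 3 ≤ q) (hn : N = q ^ 4 - q ^ 2 + 1)
    (hgap : (q ^ 3 + 1) * E < (q ^ 2 - q) * N) (hpos : 0 < E)
    (h : Deviation q N E E) : E = (q - 1) ^ 2 := by
  have hN : 0 < N := by
    rw [hn]; nlinarith [pow_pos (by linarith : 0 < q) 2]
  have hq0 : 0 < q := by linarith
  have h1 := h.step_of_pos hq hN hgap hpos
  have h2 := (h1.step hq hN hgap).resolve_left fun h2 =>
    not_pow_four_mul_self (N := N) hq hpos (by convert h2 using 1; ring)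
  -- The word 2, 1, 2 is impossible: the lower bound gives (q²+q+1)E ≤ N, hence E ≤ q² - q - 1,
  -- while the upper bound needs (q⁵+1)E ≥ q²(q-1)N.
  have h3 := (h2.step hq hN hgap).resolve_left fun h3 => by
    have ha := h3.le
    have hb := h3.lower
    have hb' : (q ^ 3 - 1) * (q ^ 3 + 1) * E ≤ (q - 1) * (q ^ 3 + 1) * N := by linarith
    have hub : E ≤ q ^ 2 - q - 1 := by
      by_contra! hc
      have h5 : (q - 1) * (q ^ 3 + 1) * ((q ^ 2 + q + 1) * (q ^ 2 - q)) ≤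
          (q - 1) * (q ^ 3 + 1) * ((q ^ 2 + q + 1) * E) := by
        refine mul_le_mul_of_nonneg_left (mul_le_mul_of_nonneg_left (by linarith) (by positivity))
          (mul_nonneg (by linarith) (by positivity))
      have h6 : (q - 1) * (q ^ 3 + 1) * ((q ^ 2 + q + 1) * (q ^ 2 - q)) ≤
          (q - 1) * (q ^ 3 + 1) * N := by linarith
      have h7 := le_of_mul_le_mul_left h6 (mul_pos (by linarith) (by positivity))
      rw [hn] at h7
      nlinarith
    have h5 : (q ^ 5 + 1) * E ≤ (q ^ 5 + 1) * (q ^ 2 - q - 1) :=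
      mul_le_mul_of_nonneg_left hub (by positivity)
    rw [hn] at ha
    nlinarith [pow_pos hq0 3, pow_pos hq0 4]
  -- After 2, 1, 1 the deviation is (q-1)²N - q⁴E. Its lower bound gives u < 1, its upper bound u >
  -- -1.
  obtain ⟨u, rfl⟩ : ∃ u, E = (q - 1) ^ 2 + u := ⟨E - (q - 1) ^ 2, by ring⟩
  have ha := h3.le
  have hb := h3.lower
  subst hn
  have hu0 : u < 1 := by
    by_contra! hc
    have h5 : (q ^ 5 - 1) * 1 ≤ (q ^ 5 - 1) * u := by
      refine mul_le_mul_of_nonneg_left hc ?_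
      have : 1 ≤ q ^ 5 := one_le_pow₀ (by linarith)
      linarith
    have h6 : 1 ≤ q ^ 4 := one_le_pow₀ (by linarith)
    have h7 : 1 ≤ q ^ 3 := one_le_pow₀ (by linarith)
    have h8 : 0 ≤ q ^ 4 * (q - 3) := mul_nonneg (by positivity) (by linarith)
    linarith
  have hu1 : -1 < u := by
    by_contra! hc
    have h5 : (q ^ 4 + 1) * u ≤ (q ^ 4 + 1) * (-1) :=
      mul_le_mul_of_nonneg_left hc (by positivity)
    nlinarith [pow_pos hq0 3, pow_pos hq0 4, pow_pos hq0 2]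
  have : u = 0 := by omega
  rw [this]; ring

/-- Modulo q + 1 one has q ≡ -1, so q^m + 1 ≡ 2 for even m. -/
theorem not_add_one_dvd_pow_add_one {q : ℤ} (hq : 3 ≤ q) {m : ℕ} (hm : Even m) :
    ¬ q + 1 ∣ q ^ m + 1 := by
  intro h
  have h1 : q + 1 ∣ q ^ m - 1 := by
    have := sub_dvd_pow_sub_pow q (-1) m
    rwa [hm.neg_one_pow, sub_neg_eq_add] at this
  have h2 : q + 1 ∣ 2 := by
    have := dvd_sub h h1
    rwa [show q ^ m + 1 - (q ^ m - 1) = 2 by ring] at this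
  have := Int.le_of_dvd (by norm_num) h2
  linarith

/-- The three smallest values of the maximum of an orbit of multiplication by `q` modulo
`q ^ (4 * j + 6) + 1`, with respect to representatives of least absolute value. -/
theorem OrbitBounded.eq_of_lt {q N E₃ M : ℤ} {j : ℕ} (hq : 3 ≤ q)
    (hn : (q ^ 2 + 1) * N = q ^ (4 * j + 6) + 1)
    (hE₃ : (q ^ 2 + 1) * E₃ = (q - 1) ^ 2 * (q ^ (4 * j + 2) + 1)) (hM : 0 ≤ M)
    (hlt : M < q * N + E₃ + if j = 0 then q * (q - 1) ^ 2 else (q - 1) ^ 2 * (q ^ 2 - 1))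
    (h : OrbitBounded q (q ^ (4 * j + 6) + 1) M M) :
    M = 0 ∨ M = q * N ∨ M = q * N + E₃ := by
  have hc : 0 < q ^ 2 + 1 := by positivity
  have hN : 0 < N := by
    have : 0 < (q ^ 2 + 1) * N := by rw [hn]; positivity
    exact pos_of_mul_pos_right this (by positivity)
  rcases hM.eq_or_lt with hM | hM
  · exact Or.inl hM.symm
  right
  obtain ⟨E, rfl⟩ : ∃ E, M = q * N + E := ⟨M - q * N, by ring⟩
  rw [← hn] at h
  have hqq : 0 < q ^ 2 - q := by nlinarith
  rcases lt_trichotomy E 0 with hE | rfl | hE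
  · exfalso
    have hgap : (q ^ 3 + 1) * E < (q ^ 2 - q) * N :=
      (mul_neg_of_pos_of_neg (by positivity) hE).trans (mul_pos hqq hN)
    have h1 := (deviation_self hq hN hgap hM h).eq_of_neg hq hN hgap hE
    refine not_add_one_dvd_pow_add_one hq (m := 4 * j + 6) ⟨2 * j + 3, by ring⟩
      ⟨q * N + E, ?_⟩
    rw [← hn]
    linear_combination -h1
  · left; ring
  · right
    congr 1
    rcases j with _ | i
    · rw [if_pos rfl] at hlt
      have hN' : N = q ^ 4 - q ^ 2 + 1 := by
        refine mul_left_cancel₀ hc.ne' ?_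
        rw [hn]; ring
      have hE₃' : E₃ = (q - 1) ^ 2 := by
        refine mul_left_cancel₀ hc.ne' ?_
        rw [hE₃]; ring
      have hgap : (q ^ 3 + 1) * E < (q ^ 2 - q) * N := by
        have h1 : E ≤ (q - 1) ^ 2 * (q + 1) - 1 := by
          rw [hE₃'] at hlt
          linarith
        have h2 : (q ^ 3 + 1) * E ≤ (q ^ 3 + 1) * ((q - 1) ^ 2 * (q + 1) - 1) :=
          mul_le_mul_of_nonneg_left h1 (by positivity)
        have h3 : 0 < q ^ 2 := by positivity
        rw [hN']
        nlinarith
      rw [hE₃']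
      exact (deviation_self hq hN hgap hM h).eq_of_pos_six hq hN' hgap hE
    · rw [if_neg (by omega)] at hlt
      have hlt' : E < E₃ + (q - 1) ^ 2 * (q ^ 2 - 1) := by linarith
      have hEK := lt_of_lt_fourth hq hE₃ hlt'
      have hn' : (q ^ 2 + 1) * N = q ^ 10 * q ^ (4 * i) + 1 := by rw [hn]; ring
      obtain ⟨-, hgap⟩ :=
        maximal_deviation_bounds hq (one_le_pow₀ (by linarith)) hn' hE hEK
      exact (deviation_self hq hN hgap hM h).eq_of_pos hq hn hE₃ hEK hlt' hE

/-! ### Explicit orbits -/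

theorem dvd_step {q n M z w : ℤ} {t : ℕ} (h : n ∣ z - q ^ t * M) (k : ℤ) (hw : w = q * z + k * n) :
    n ∣ w - q ^ (t + 1) * M := by
  obtain ⟨l, hl⟩ := h
  exact ⟨q * l + k, by rw [hw]; linear_combination q * hl⟩

/-- The orbit of `q * N + E` whose word of gaps starts with `2, 1, 1`, continues with `l` times `2`
and then `1, 1`. -/
theorem orbit_of_run {q N E f E' : ℤ} {l : ℕ} (hl : Even l) (hq : 3 ≤ q) (hN : 0 < N) (hE : 0 < E)
    (hEN : q ^ 3 * E < (q - 1) * N) (hf : q ^ 4 * E = (q - 1) ^ 2 * N + f) (hf0 : 0 < f)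
    (hrun : ∀ i < l, q ^ (2 * i) * f < E) (hend : q ^ (2 * l) * f < q ^ 2 * E)
    (hE' : E' = (q - 1) ^ 2 * N - q ^ (2 * l + 2) * f) :
    (∀ t, 0 < t → t < 2 * l + 6 → ∃ z : ℤ,
      (q ^ 2 + 1) * N ∣ z - q ^ t * (q * N + E) ∧ |z| < q * N + E) ∧
    (q ^ 2 + 1) * N ∣ -(q * N + E') - q ^ (2 * l + 6) * (q * N + E) := by
  have hqE : q * E < N := by
    have h1 : q * (q * (q * E)) < q * N := by linarith
    have h2 := lt_of_mul_lt_mul_left h1 (by linarith)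
    nlinarith
  have hq2E : q ^ 2 * E < N := by
    have h1 : q * (q ^ 2 * E) < q * N := by linarith
    exact lt_of_mul_lt_mul_left h1 (by linarith)
  have hqE0 : 0 < q * E := by positivity
  have hq2E0 : 0 < q ^ 2 * E := by positivity
  have hq3E0 : 0 < q ^ 3 * E := by positivity
  have h3N : 3 * N ≤ q * N := mul_le_mul_of_nonneg_right hq hN.le
  have r1 : (q ^ 2 + 1) * N ∣ (q * E - N) - q ^ 1 * (q * N + E) := ⟨-1, by ring⟩
  have r2 : (q ^ 2 + 1) * N ∣ (q ^ 2 * E - q * N) - q ^ 2 * (q * N + E) :=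
    dvd_step r1 0 (by ring)
  have r3 : (q ^ 2 + 1) * N ∣ (q ^ 3 * E + N) - q ^ 3 * (q * N + E) :=
    dvd_step r2 1 (by ring)
  have r4 : (q ^ 2 + 1) * N ∣ (f - q * N) - q ^ 4 * (q * N + E) :=
    dvd_step r3 (-1) (by linear_combination -hf)
  have run : ∀ i : ℕ, (q ^ 2 + 1) * N ∣
      (q ^ (2 * i) * f - (-1) ^ i * (q * N)) - q ^ (2 * i + 4) * (q * N + E) := by
    intro i
    induction i with
    | zero => simpa using r4
    | succ i ih =>
      exact dvd_step (dvd_step ih 0 rfl) ((-1) ^ i * q) (by ring)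
  have odd : ∀ i : ℕ, (q ^ 2 + 1) * N ∣
      (q * (q ^ (2 * i) * f) + (-1) ^ i * N) - q ^ (2 * i + 5) * (q * N + E) := fun i =>
    dvd_step (run i) ((-1) ^ i) (by ring)
  have hP : ∀ i : ℕ, 0 < q ^ (2 * i) * f := fun i => by positivity
  refine ⟨fun t ht0 ht => ?_, ?_⟩
  · obtain rfl | rfl | rfl | ⟨i, hi, rfl⟩ | ⟨i, hi, rfl⟩ : t = 1 ∨ t = 2 ∨ t = 3 ∨
        (∃ i, i ≤ l ∧ t = 2 * i + 4) ∨ ∃ i, i ≤ l ∧ t = 2 * i + 5 := by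
      rcases Nat.lt_or_ge t 4 with h | h
      · omega
      · rcases Nat.even_or_odd' (t - 4) with ⟨i, hi | hi⟩
        · exact Or.inr (Or.inr (Or.inr (Or.inl ⟨i, by omega, by omega⟩)))
        · exact Or.inr (Or.inr (Or.inr (Or.inr ⟨i, by omega, by omega⟩)))
    · exact ⟨_, r1, by rw [abs_lt]; constructor <;> linarith⟩
    · exact ⟨_, r2, by rw [abs_lt]; constructor <;> linarith⟩
    · exact ⟨_, r3, by rw [abs_lt]; constructor <;> linarith⟩
    · refine ⟨_, run i, ?_⟩
      have := hP i
      rcases hi.lt_or_eq with hi | rfl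
      · have := hrun i hi
        rcases neg_one_pow_eq_or ℤ i with h | h <;> rw [h, abs_lt] <;> constructor <;> linarith
      · rw [hl.neg_one_pow, abs_lt]; constructor <;> linarith
    · refine ⟨_, odd i, ?_⟩
      have h1 : 0 < q * (q ^ (2 * i) * f) := mul_pos (by linarith) (hP i)
      rcases hi.lt_or_eq with hi | rfl
      · have h2 : q * (q ^ (2 * i) * f) < q * E := mul_lt_mul_of_pos_left (hrun i hi) (by linarith)
        rcases neg_one_pow_eq_or ℤ i with h | h <;> rw [h, abs_lt] <;> constructor <;> linarith
      · have h2 : q * (q ^ (2 * i) * f) < q * (q ^ 2 * E) :=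
          mul_lt_mul_of_pos_left hend (by linarith)
        rw [hl.neg_one_pow, abs_lt]; constructor <;> linarith
  · refine dvd_step (odd l) (-1) ?_
    rw [hl.neg_one_pow, hE', pow_add]
    ring

/-- The word of gaps is 2, 1, 1, then 2j times 2, then 1, 1, of total length 4j + 6 = m. -/
theorem third_orbit {q N E : ℤ} {j : ℕ} (hq : 3 ≤ q) (hN : (q ^ 2 + 1) * N = q ^ (4 * j + 6) + 1)
    (hE : (q ^ 2 + 1) * E = (q - 1) ^ 2 * (q ^ (4 * j + 2) + 1)) {t : ℕ} (ht0 : 0 < t)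
    (ht : t < 4 * j + 6) :
    ∃ z : ℤ, (q ^ 2 + 1) * N ∣ z - q ^ t * (q * N + E) ∧ |z| < q * N + E := by
  have hc : 0 < q ^ 2 + 1 := by positivity
  have hq1 : 0 < q - 1 := by linarith
  have hq2 : 0 < q ^ 2 - 1 := by nlinarith
  have hN0 : 0 < N := pos_of_mul_pos_right (hN ▸ by positivity) hc.le
  have hE0 : 0 < E := pos_of_mul_pos_right (hE ▸ by positivity) hc.le
  have hQ : 1 ≤ q ^ (4 * j) := one_le_pow₀ (by linarith)
  have hN' : (q ^ 2 + 1) * N = q ^ 6 * q ^ (4 * j) + 1 := by rw [hN]; ring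
  have hE' : (q ^ 2 + 1) * E = (q - 1) ^ 2 * (q ^ 2 * q ^ (4 * j) + 1) := by rw [hE]; ring
  refine (orbit_of_run (l := 2 * j) (f := (q - 1) ^ 2 * (q ^ 2 - 1)) (even_two_mul j) hq hN0 hE0
    ?_ ?_ (by positivity) ?_ ?_ rfl).1 t ht0 (by omega)
  · refine lt_of_mul_lt_mul_left (a := q ^ 2 + 1) ?_ hc.le
    have h1 : (q ^ 2 + 1) * (q ^ 3 * E) = (q - 1) * (q ^ 3 * ((q - 1) * (q ^ 2 * q ^ (4 * j) + 1))) := by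
      linear_combination q ^ 3 * hE'
    have h2 : (q ^ 2 + 1) * ((q - 1) * N) = (q - 1) * (q ^ 6 * q ^ (4 * j) + 1) := by
      linear_combination (q - 1) * hN'
    rw [h1, h2]
    refine mul_lt_mul_of_pos_left ?_ hq1
    have h3 : q ^ 3 * (q - 1) * 1 ≤ q ^ 3 * (q - 1) * q ^ (4 * j) :=
      mul_le_mul_of_nonneg_left hQ (by positivity)
    have h4 : 0 ≤ q ^ 3 * q ^ (4 * j) * (q ^ 2 - q + 1) :=
      mul_nonneg (by positivity) (by nlinarith)
    linarith
  · refine mul_left_cancel₀ hc.ne' ?_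
    linear_combination q ^ 4 * hE' - (q - 1) ^ 2 * hN'
  · intro i hi
    refine lt_of_mul_lt_mul_left (a := q ^ 2 + 1) ?_ hc.le
    have h1 : q ^ (2 * i) * q ^ 2 ≤ q ^ (4 * j) := by
      rw [← pow_add]; exact pow_le_pow_right₀ (by linarith) (by omega)
    have h2 : (q - 1) ^ 2 * q ^ 2 * (q ^ (2 * i) * q ^ 2) ≤ (q - 1) ^ 2 * q ^ 2 * q ^ (4 * j) :=
      mul_le_mul_of_nonneg_left h1 (by positivity)
    have h3 : 0 < (q - 1) ^ 2 * q ^ (2 * i) := by positivity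
    have h4 : 0 < (q - 1) ^ 2 := by positivity
    linarith
  · refine lt_of_mul_lt_mul_left (a := q ^ 2 + 1) ?_ hc.le
    rw [show 2 * (2 * j) = 4 * j by ring]
    have h3 : 0 < (q - 1) ^ 2 * q ^ (4 * j) := by positivity
    have h4 : 0 < (q - 1) ^ 2 * q ^ 2 := by positivity
    have h5 : (q ^ 2 + 1) * (q ^ 2 * E) =
        q ^ 2 * ((q - 1) ^ 2 * (q ^ 2 * q ^ (4 * j) + 1)) := by
      linear_combination q ^ 2 * hE'
    linarith

/-- The word of `orbit_of_run` with 2i gaps 2 in its run ends at time m - 4 with deviation G = E/q⁴.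
Two more gaps 2 multiply it by q⁴ and restore E. -/
theorem fourth_orbit {q N E : ℤ} {i : ℕ} (hq : 3 ≤ q)
    (hN : (q ^ 2 + 1) * N = q ^ (4 * (i + 1) + 6) + 1)
    (hE : (q ^ 2 + 1) * E = (q - 1) ^ 2 * (q ^ (4 * (i + 1) + 2) + q ^ 4)) {t : ℕ} (ht0 : 0 < t)
    (ht : t < 4 * (i + 1) + 6) :
    ∃ z : ℤ, (q ^ 2 + 1) * N ∣ z - q ^ t * (q * N + E) ∧ |z| < q * N + E := by
  have hc : 0 < q ^ 2 + 1 := by positivity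
  have hq1 : 0 < q - 1 := by linarith
  have hq2 : 0 < q ^ 2 - 1 := by nlinarith
  have hN0 : 0 < N := pos_of_mul_pos_right (hN ▸ by positivity) hc.le
  have hE0 : 0 < E := pos_of_mul_pos_right (hE ▸ by positivity) hc.le
  have hQ : 1 ≤ q ^ (4 * i) := one_le_pow₀ (by linarith)
  have hN' : (q ^ 2 + 1) * N = q ^ 10 * q ^ (4 * i) + 1 := by rw [hN]; ring
  have hE' : (q ^ 2 + 1) * E = (q - 1) ^ 2 * (q ^ 6 * q ^ (4 * i) + q ^ 4) := by rw [hE]; ring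
  obtain ⟨G, hG⟩ : ∃ G, G = (q - 1) ^ 2 * N -
      q ^ (2 * (2 * i) + 2) * ((q - 1) ^ 2 * (q ^ 2 - 1) * (q ^ 4 + 1)) := ⟨_, rfl⟩
  have hEN : q ^ 3 * E < (q - 1) * N := by
    refine lt_of_mul_lt_mul_left (a := q ^ 2 + 1) ?_ hc.le
    have h1 : (q ^ 2 + 1) * (q ^ 3 * E) =
        (q - 1) * (q ^ 3 * ((q - 1) * (q ^ 6 * q ^ (4 * i) + q ^ 4))) := by
      linear_combination q ^ 3 * hE'
    have h2 : (q ^ 2 + 1) * ((q - 1) * N) = (q - 1) * (q ^ 10 * q ^ (4 * i) + 1) := by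
      linear_combination (q - 1) * hN'
    rw [h1, h2]
    refine mul_lt_mul_of_pos_left ?_ hq1
    have h3 : q ^ 7 * (q - 1) * 1 ≤ q ^ 7 * (q - 1) * q ^ (4 * i) :=
      mul_le_mul_of_nonneg_left hQ (by positivity)
    have h4 : 0 ≤ q ^ 7 * q ^ (4 * i) * (q ^ 2 - q + 1) :=
      mul_nonneg (by positivity) (by nlinarith)
    linarith
  obtain ⟨hrun, hlast⟩ := orbit_of_run (l := 2 * i)
    (f := (q - 1) ^ 2 * (q ^ 2 - 1) * (q ^ 4 + 1)) (even_two_mul i) hq hN0 hE0 hEN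
    (by refine mul_left_cancel₀ hc.ne' ?_
        linear_combination q ^ 4 * hE' - (q - 1) ^ 2 * hN')
    (by positivity)
    (by intro b hb
        refine lt_of_mul_lt_mul_left (a := q ^ 2 + 1) ?_ hc.le
        have h1 : q ^ (2 * b) * q ^ 2 ≤ q ^ (4 * i) := by
          rw [← pow_add]; exact pow_le_pow_right₀ (by linarith) (by omega)
        have h2 : (q - 1) ^ 2 * q ^ 6 * (q ^ (2 * b) * q ^ 2) ≤
            (q - 1) ^ 2 * q ^ 6 * q ^ (4 * i) := mul_le_mul_of_nonneg_left h1 (by positivity)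
        have h3 : 0 < (q - 1) ^ 2 * q ^ (2 * b) := by positivity
        have h4 : 0 < (q - 1) ^ 2 * q ^ 4 := by positivity
        linarith)
    (by refine lt_of_mul_lt_mul_left (a := q ^ 2 + 1) ?_ hc.le
        rw [show 2 * (2 * i) = 4 * i by ring]
        have h3 : 0 < (q - 1) ^ 2 * q ^ (4 * i) := by positivity
        have h4 : 0 < (q - 1) ^ 2 * q ^ 6 := by positivity
        have h5 : (q ^ 2 + 1) * (q ^ 2 * E) =
            q ^ 2 * ((q - 1) ^ 2 * (q ^ 6 * q ^ (4 * i) + q ^ 4)) := by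
          linear_combination q ^ 2 * hE'
        linarith) hG
  have hGc : (q ^ 2 + 1) * G = (q - 1) ^ 2 * (q ^ 2 * q ^ (4 * i) + 1) := by
    rw [hG, pow_add, show 2 * (2 * i) = 4 * i by ring]
    linear_combination (q - 1) ^ 2 * hN'
  have hGE : q ^ 4 * G = E := by
    refine mul_left_cancel₀ hc.ne' ?_
    linear_combination q ^ 4 * hGc - hE'
  have hG0 : 0 < G := pos_of_mul_pos_right (hGc ▸ by positivity) hc.le
  rcases Nat.lt_or_ge t (2 * (2 * i) + 6) with hlt | hge
  · exact hrun t ht0 hlt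
  have hq2G : q ^ 2 * G < E := by
    rw [← hGE]
    exact mul_lt_mul_of_pos_right (pow_lt_pow_right₀ (by linarith) (by norm_num)) hG0
  have hqG : q * G ≤ q ^ 2 * G := by nlinarith [mul_pos hq1 hG0]
  have hGq : G ≤ q * G := by nlinarith
  have hqG0 : 0 < q * G := by positivity
  have hqE : q ^ 3 * G ≤ E := by
    rw [← hGE]
    exact mul_le_mul_of_nonneg_right (pow_le_pow_right₀ (by linarith) (by norm_num)) hG0.le
  have hq3G : 0 < q ^ 3 * G := by positivity
  have h3N : 3 * N ≤ q * N := mul_le_mul_of_nonneg_right hq hN0.le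
  have hEN' : E < N := by
    have h1 : q * E ≤ q ^ 3 * E :=
      mul_le_mul_of_nonneg_right (le_self_pow₀ (by linarith) (by norm_num)) hE0.le
    have : q * E < q * N := by linarith
    exact lt_of_mul_lt_mul_left this (by linarith)
  have r1 : (q ^ 2 + 1) * N ∣ (N - q * G) - q ^ (2 * (2 * i) + 6 + 1) * (q * N + E) :=
    dvd_step hlast 1 (by ring)
  have r2 : (q ^ 2 + 1) * N ∣ (q * N - q ^ 2 * G) - q ^ (2 * (2 * i) + 6 + 2) * (q * N + E) :=
    dvd_step r1 0 (by ring)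
  have r3 : (q ^ 2 + 1) * N ∣ (-N - q ^ 3 * G) - q ^ (2 * (2 * i) + 6 + 3) * (q * N + E) :=
    dvd_step r2 (-1) (by ring)
  obtain rfl | rfl | rfl | rfl : t = 2 * (2 * i) + 6 ∨ t = 2 * (2 * i) + 6 + 1 ∨
      t = 2 * (2 * i) + 6 + 2 ∨ t = 2 * (2 * i) + 6 + 3 := by omega
  · exact ⟨_, hlast, by rw [abs_lt]; constructor <;> linarith⟩
  · exact ⟨_, r1, by rw [abs_lt]; constructor <;> linarith⟩
  · exact ⟨_, r2, by rw [abs_lt]; constructor <;> linarith⟩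
  · exact ⟨_, r3, by rw [abs_lt]; constructor <;> linarith⟩

theorem fourth_orbit_six {q : ℤ} (hq : 3 ≤ q) {t : ℕ} (ht0 : 0 < t) (ht : t < 6) :
    ∃ z : ℤ, q ^ 6 + 1 ∣ z - q ^ t * (q ^ 5 - q ^ 2 + 1) ∧ |z| < q ^ 5 - q ^ 2 + 1 := by
  have h1 : 3 * q ≤ q ^ 2 := by nlinarith
  have h2 : 3 * q ^ 2 ≤ q ^ 3 := by nlinarith [sq_nonneg q]
  have h3 : 3 * q ^ 3 ≤ q ^ 4 := by nlinarith [pow_pos (by linarith : 0 < q) 3]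
  have h4 : 3 * q ^ 4 ≤ q ^ 5 := by nlinarith [pow_pos (by linarith : 0 < q) 4]
  interval_cases t
  · exact ⟨-q ^ 3 + q - 1, ⟨-1, by ring⟩, by rw [abs_lt]; constructor <;> linarith⟩
  · exact ⟨-q ^ 4 + q ^ 2 - q, ⟨-q, by ring⟩, by rw [abs_lt]; constructor <;> linarith⟩
  · exact ⟨-q ^ 5 + q ^ 3 - q ^ 2, ⟨-q ^ 2, by ring⟩, by rw [abs_lt]; constructor <;> linarith⟩
  · exact ⟨q ^ 4 - q ^ 3 + 1, ⟨-q ^ 3 + 1, by ring⟩, by rw [abs_lt]; constructor <;> linarith⟩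
  · exact ⟨q ^ 5 - q ^ 4 + q, ⟨-q ^ 4 + q, by ring⟩, by rw [abs_lt]; constructor <;> linarith⟩

theorem second_orbit {q N : ℤ} (hq : 3 ≤ q) (hN : 0 < N) (t : ℕ) :
    ∃ z : ℤ, (q ^ 2 + 1) * N ∣ z - q ^ t * (q * N) ∧ |z| ≤ q * N := by
  have h3N : 3 * N ≤ q * N := mul_le_mul_of_nonneg_right hq hN.le
  suffices ∃ z : ℤ, (q ^ 2 + 1) * N ∣ z - q ^ t * (q * N) ∧
      (z = q * N ∨ z = -N ∨ z = -(q * N) ∨ z = N) by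
    obtain ⟨z, h, hz⟩ := this
    refine ⟨z, h, ?_⟩
    rw [abs_le]
    rcases hz with rfl | rfl | rfl | rfl <;> constructor <;> linarith
  induction t with
  | zero => exact ⟨q * N, by simp, Or.inl rfl⟩
  | succ t ih =>
    obtain ⟨z, h, rfl | rfl | rfl | rfl⟩ := ih
    · exact ⟨-N, dvd_step h (-1) (by ring), by simp⟩
    · exact ⟨-(q * N), dvd_step h 0 (by ring), by simp⟩
    · exact ⟨N, dvd_step h 1 (by ring), by simp⟩
    · exact ⟨q * z, dvd_step h 0 (by ring), by simp⟩

/-! ### Cyclotomic cosets modulo `q ^ m + 1` -/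

theorem natCast_pow_eq_neg_one (q m : ℕ) : (q : ZMod (q ^ m + 1)) ^ m = -1 := by
  have h : ((q ^ m + 1 : ℕ) : ZMod (q ^ m + 1)) = 0 := ZMod.natCast_self _
  push_cast at h
  exact eq_neg_of_add_eq_zero_left h

theorem natCast_pow_two_mul_eq_one (q m : ℕ) : (q : ZMod (q ^ m + 1)) ^ (2 * m) = 1 := by
  rw [mul_comm, pow_mul, natCast_pow_eq_neg_one]
  ring

theorem orderOf_natCast_pos (q : ℕ) {m : ℕ} (hm : 0 < m) :
    0 < orderOf (q : ZMod (q ^ m + 1)) :=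
  Nat.pos_of_dvd_of_pos (orderOf_dvd_of_pow_eq_one (natCast_pow_two_mul_eq_one q m)) (by omega)

theorem mul_pow_mod_mem_cyclotomicCoset (q : ℕ) {m : ℕ} (hm : 0 < m) (x i : ℕ) :
    x * q ^ i % (q ^ m + 1) ∈ cyclotomicCoset q (q ^ m + 1) x := by
  refine Finset.mem_image.mpr ⟨i % orderOf (q : ZMod (q ^ m + 1)),
    Finset.mem_range.mpr (Nat.mod_lt _ (orderOf_natCast_pos q hm)), ?_⟩
  rw [← ZMod.natCast_eq_natCast_iff']
  push_cast
  rw [pow_mod_orderOf]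

/-- The midpoint h of the modulus 2h is fixed by multiplication by q, so cosets can be recentred at
h. -/
theorem dvd_half_mul_pow_sub {q h : ℕ} (hq : Odd q) (t : ℕ) :
    (2 * h : ℤ) ∣ h * q ^ t - h := by
  have hodd : Odd ((q : ℤ) ^ t) := ((Int.odd_coe_nat q).mpr hq).pow
  obtain ⟨k, hk⟩ := hodd
  exact ⟨k, by rw [hk]; ring⟩

/-- The residue of δ q^t is congruent to h - z, which lies in [h - M, h + M] = [δ, n - δ]. -/
theorem le_mul_pow_mod {q n h δ : ℕ} {M : ℤ} (hq : Odd q) (hn : n = 2 * h) (hh : 0 < h)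
    (hδ : (δ : ℤ) = h - M) {t : ℕ}
    (hz : ∃ z : ℤ, (n : ℤ) ∣ z - (q : ℤ) ^ t * M ∧ |z| ≤ M) : δ ≤ δ * q ^ t % n := by
  obtain ⟨z, ⟨a, ha⟩, hzM⟩ := hz
  obtain ⟨hz1, hz2⟩ := abs_le.mp hzM
  obtain ⟨b, hb⟩ := dvd_half_mul_pow_sub (h := h) hq t
  have hn' : (n : ℤ) = 2 * h := by rw [hn]; push_cast; ring
  have hdiv : (n : ℤ) * (δ * q ^ t / n : ℕ) + (δ * q ^ t % n : ℕ) = δ * (q : ℤ) ^ t := by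
    exact_mod_cast Nat.div_add_mod (δ * q ^ t) n
  generalize (δ * q ^ t / n : ℕ) = c at hdiv
  generalize δ * q ^ t % n = r at hdiv ⊢
  have key : (r : ℤ) - (h - z) = n * (b + a - c) := by
    rw [hδ] at hdiv
    rw [hn'] at hdiv ha ⊢
    linear_combination hdiv + hb + ha
  by_contra! hlt
  have hlt' : (r : ℤ) < δ := by exact_mod_cast hlt
  have hδ0 : (0 : ℤ) ≤ δ := by positivity
  have hr0 : (0 : ℤ) ≤ r := by positivity
  have hn0 : (0 : ℤ) < n := by omega
  have h1 : b + a - c < 0 := by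
    by_contra! hc
    have := mul_nonneg hn0.le hc
    linarith
  have h2 : (n : ℤ) * (b + a - c) ≤ n * (-1) := mul_le_mul_of_nonneg_left (by omega) hn0.le
  linarith

theorem mem_minRep_of_orbit {q m h δ : ℕ} {M : ℤ} (hq : Odd q) (hm : 0 < m)
    (hn : q ^ m + 1 = 2 * h) (hδ : (δ : ℤ) = h - M)
    (hz : ∀ t : ℕ, ∃ z : ℤ, ((q ^ m + 1 : ℕ) : ℤ) ∣ z - (q : ℤ) ^ t * M ∧ |z| ≤ M) :
    δ ∈ minRep q (q ^ m + 1) := by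
  have hM : 0 ≤ M := by
    obtain ⟨z, -, h⟩ := hz 0
    exact (abs_nonneg z).trans h
  have hmem : δ % (q ^ m + 1) ∈ cyclotomicCoset q (q ^ m + 1) δ := by
    simpa using mul_pow_mod_mem_cyclotomicCoset q hm δ 0
  have hlt : δ < q ^ m + 1 := by omega
  rw [Nat.mod_eq_of_lt hlt] at hmem
  refine Finset.mem_image.mpr ⟨δ, Finset.mem_range.mpr hlt, le_antisymm ?_ ?_⟩
  · exact Nat.sInf_le (Finset.mem_coe.mpr hmem)
  · refine le_csInf ⟨δ, Finset.mem_coe.mpr hmem⟩ fun b hb => ?_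
    obtain ⟨t, -, rfl⟩ := Finset.mem_image.mp (Finset.mem_coe.mp hb)
    exact le_mul_pow_mod hq hn (by omega) hδ (hz t)

theorem le_mul_pow_mod_of_mem_minRep {q m s : ℕ} (hm : 0 < m) (hs : s ∈ minRep q (q ^ m + 1)) :
    s < q ^ m + 1 ∧ ∀ t, s ≤ s * q ^ t % (q ^ m + 1) := by
  obtain ⟨x, -, hx⟩ := Finset.mem_image.mp hs
  have hne : (cyclotomicCoset q (q ^ m + 1) x : Set ℕ).Nonempty :=
    ⟨_, Finset.mem_coe.mpr (mul_pow_mod_mem_cyclotomicCoset q hm x 0)⟩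
  have hmem := Nat.sInf_mem hne
  obtain ⟨a, -, ha⟩ := Finset.mem_image.mp (Finset.mem_coe.mp hmem)
  have ha' : x * q ^ a % (q ^ m + 1) = s := ha.trans hx
  refine ⟨ha' ▸ Nat.mod_lt _ (Nat.succ_pos _), fun t => ?_⟩
  have h1 : s * q ^ t % (q ^ m + 1) = x * q ^ (a + t) % (q ^ m + 1) := by
    rw [← ha', Nat.mod_mul_mod, pow_add, mul_assoc]
  rw [h1]
  conv_lhs => rw [← hx]
  exact Nat.sInf_le (Finset.mem_coe.mpr (mul_pow_mod_mem_cyclotomicCoset q hm x _))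

/-- Since q^m ≡ -1, the sum is a multiple of n; it lies strictly between 0 and 2n. -/
theorem mul_pow_mod_add {q m s t : ℕ} (hpos : 0 < s * q ^ t % (q ^ m + 1)) :
    s * q ^ t % (q ^ m + 1) + s * q ^ (t + m) % (q ^ m + 1) = q ^ m + 1 := by
  have hdvd : q ^ m + 1 ∣ s * q ^ t % (q ^ m + 1) + s * q ^ (t + m) % (q ^ m + 1) := by
    rw [Nat.dvd_iff_mod_eq_zero, ← Nat.add_mod, pow_add,
      show s * q ^ t + s * (q ^ t * q ^ m) = s * q ^ t * (q ^ m + 1) by ring]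
    exact Nat.mul_mod_left _ _
  have h1 : s * q ^ t % (q ^ m + 1) < q ^ m + 1 := Nat.mod_lt _ (Nat.succ_pos _)
  have h2 : s * q ^ (t + m) % (q ^ m + 1) < q ^ m + 1 := Nat.mod_lt _ (Nat.succ_pos _)
  obtain ⟨k, hk⟩ := hdvd
  have hk1 : k = 1 := by
    have : 0 < k := Nat.pos_of_ne_zero (by rintro rfl; omega)
    have : k < 2 := by
      by_contra! hc
      have := Nat.mul_le_mul_left (q ^ m + 1) hc
      omega
    omega
  rw [hk, hk1, mul_one]

/-- Minimality at time t + m, reflected by q^m ≡ -1, bounds the residue at time t above by n - s.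
The reflection needs nonzero residues, hence s > 0. -/
theorem orbitBounded_of_mem_minRep {q m h s : ℕ} (hq : Odd q) (hm : 0 < m)
    (hn : q ^ m + 1 = 2 * h) (hs : s ∈ minRep q (q ^ m + 1)) (hs0 : 0 < s) :
    s ≤ h ∧ OrbitBounded q ((q : ℤ) ^ m + 1) (h - s) (h - s) := by
  obtain ⟨hlt, hle⟩ := le_mul_pow_mod_of_mem_minRep hm hs
  have hub : ∀ t, s * q ^ t % (q ^ m + 1) + s ≤ q ^ m + 1 := fun t => by
    have := mul_pow_mod_add (m := m) (hs0.trans_le (hle t))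
    have := hle (t + m)
    omega
  refine ⟨?_, fun t => ?_⟩
  · have := hub 0
    rw [pow_zero, mul_one, Nat.mod_eq_of_lt hlt] at this
    omega
  · obtain ⟨b, hb⟩ := dvd_half_mul_pow_sub (h := h) hq t
    have hn' : (q : ℤ) ^ m + 1 = 2 * h := by exact_mod_cast hn
    have h1 : (s : ℤ) ≤ (s * q ^ t % (q ^ m + 1) : ℕ) := by exact_mod_cast hle t
    have h2 : ((s * q ^ t % (q ^ m + 1) : ℕ) : ℤ) + s ≤ 2 * h := by
      rw [← hn']; exact_mod_cast hub t
    have hdiv : (2 * h : ℤ) * (s * q ^ t / (q ^ m + 1) : ℕ) + (s * q ^ t % (q ^ m + 1) : ℕ) =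
        s * (q : ℤ) ^ t := by
      rw [← hn']; exact_mod_cast Nat.div_add_mod (s * q ^ t) (q ^ m + 1)
    generalize (s * q ^ t / (q ^ m + 1) : ℕ) = c at hdiv
    generalize s * q ^ t % (q ^ m + 1) = r at hdiv h1 h2
    refine ⟨b - c, ?_⟩
    have : (q : ℤ) ^ t * (h - s) - (b - c) * ((q : ℤ) ^ m + 1) = h - r := by
      rw [hn']
      linear_combination hb + hdiv
    rw [this, abs_le]
    constructor <;> linarith

/-- The orbit of a point that is strictly maximal during the times `0 < t < m`, continued by
`q ^ m ≡ -1`. -/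
theorem orbit_le_of_lt {q m : ℕ} {M : ℤ} (hm : 0 < m) (hM : 0 ≤ M)
    (hz : ∀ t : ℕ, 0 < t → t < m →
      ∃ z : ℤ, ((q ^ m + 1 : ℕ) : ℤ) ∣ z - (q : ℤ) ^ t * M ∧ |z| < M) (t : ℕ) :
    ∃ z : ℤ, ((q ^ m + 1 : ℕ) : ℤ) ∣ z - (q : ℤ) ^ t * M ∧ |z| ≤ M := by
  induction t using Nat.strong_induction_on with
  | _ t ih =>
    rcases Nat.lt_or_ge t m with h | h
    · rcases Nat.eq_zero_or_pos t with rfl | h0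
      · exact ⟨M, by simp, (abs_of_nonneg hM).le⟩
      · obtain ⟨z, h1, h2⟩ := hz t h0 h
        exact ⟨z, h1, h2.le⟩
    · obtain ⟨z, ⟨k, hk⟩, h2⟩ := ih (t - m) (by omega)
      refine ⟨-z, ⟨-k - q ^ (t - m) * M, ?_⟩, by rwa [abs_neg]⟩
      have hp : (q : ℤ) ^ t = q ^ (t - m) * q ^ m := by rw [← pow_add]; congr 1; omega
      rw [hp]
      push_cast at hk ⊢
      linear_combination -hk

/-- If q^d M ≡ M, then n divides M - z, 2M or M + z according as d < m, d = m or d > m. All three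
are positive and at most 2M < n. -/
theorem not_dvd_pow_sub_one_mul {q m : ℕ} {M : ℤ} (hM : 0 < M)
    (hMn : 2 * M < (q ^ m + 1 : ℕ))
    (hz : ∀ t : ℕ, 0 < t → t < m →
      ∃ z : ℤ, ((q ^ m + 1 : ℕ) : ℤ) ∣ z - (q : ℤ) ^ t * M ∧ |z| < M)
    {d : ℕ} (hd0 : 0 < d) (hd : d < 2 * m) :
    ¬ ((q ^ m + 1 : ℕ) : ℤ) ∣ ((q : ℤ) ^ d - 1) * M := by
  intro hdvd
  have small : ∀ w : ℤ, 0 < w → w ≤ 2 * M → ¬ ((q ^ m + 1 : ℕ) : ℤ) ∣ w := fun w h0 h1 h2 => by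
    have := Int.le_of_dvd h0 h2
    linarith
  rcases lt_trichotomy d m with h | rfl | h
  · obtain ⟨z, h1, h2⟩ := hz d hd0 h
    obtain ⟨h3, h4⟩ := abs_lt.mp h2
    refine small (M - z) (by linarith) (by linarith) ?_
    have := (dvd_add h1 hdvd).neg_right
    refine this.trans (Eq.dvd ?_)
    ring
  · refine small (2 * M) (by linarith) le_rfl ?_
    have h1 : ((q ^ d + 1 : ℕ) : ℤ) ∣ ((q ^ d + 1 : ℕ) : ℤ) * M := dvd_mul_right _ _
    have := dvd_sub h1 hdvd
    refine this.trans (Eq.dvd ?_)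
    push_cast
    ring
  · obtain ⟨z, h1, h2⟩ := hz (d - m) (by omega) (by omega)
    obtain ⟨h3, h4⟩ := abs_lt.mp h2
    refine small (M + z) (by linarith) (by linarith) ?_
    have hp : (q : ℤ) ^ d = q ^ (d - m) * q ^ m := by rw [← pow_add]; congr 1; omega
    have h5 : ((q ^ m + 1 : ℕ) : ℤ) ∣ ((q ^ m + 1 : ℕ) : ℤ) * (q ^ (d - m) * M) :=
      dvd_mul_right _ _
    have := dvd_sub (dvd_add h1 h5) hdvd
    refine this.trans (Eq.dvd ?_)
    rw [hp]
    push_cast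
    ring

theorem card_cyclotomicCoset {q m h δ : ℕ} {M : ℤ} (hq : Odd q) (hm : 0 < m)
    (hn : q ^ m + 1 = 2 * h) (hδ : (δ : ℤ) = h - M) (hδ0 : 0 < δ) (hM : 0 < M)
    (hz : ∀ t : ℕ, 0 < t → t < m →
      ∃ z : ℤ, ((q ^ m + 1 : ℕ) : ℤ) ∣ z - (q : ℤ) ^ t * M ∧ |z| < M) :
    (cyclotomicCoset q (q ^ m + 1) δ).card = 2 * m := by
  have hn' : ((q ^ m + 1 : ℕ) : ℤ) = 2 * h := by rw [hn]; push_cast; ring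
  have hMn : 2 * M < (q ^ m + 1 : ℕ) := by
    rw [hn']
    have : (0 : ℤ) < δ := by exact_mod_cast hδ0
    linarith
  have key : ∀ d, 0 < d → d < 2 * m → ¬ ((q ^ m + 1 : ℕ) : ℤ) ∣ δ * ((q : ℤ) ^ d - 1) := by
    intro d hd0 hd hdvd
    refine not_dvd_pow_sub_one_mul hM hMn hz hd0 hd ?_
    have h1 := dvd_half_mul_pow_sub (h := h) hq d
    rw [← hn'] at h1
    have := dvd_sub h1 hdvd
    refine this.trans (Eq.dvd ?_)
    rw [hδ]
    ring
  -- The order divides 2m, and a smaller one would be an exponent excluded by `key`.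
  have hord : orderOf (q : ZMod (q ^ m + 1)) = 2 * m := by
    have hdvd := orderOf_dvd_of_pow_eq_one (natCast_pow_two_mul_eq_one q m)
    by_contra hne
    have hlt := lt_of_le_of_ne (Nat.le_of_dvd (by omega) hdvd) hne
    refine key _ (orderOf_natCast_pos q hm) hlt (Dvd.dvd.mul_left ?_ _)
    rw [← ZMod.intCast_zmod_eq_zero_iff_dvd]
    push_cast
    rw [pow_orderOf_eq_one, sub_self]
  have hcop : IsCoprime ((q ^ m + 1 : ℕ) : ℤ) (q : ℤ) := by
    obtain ⟨k, rfl⟩ : ∃ k, m = k + 1 := ⟨m - 1, by omega⟩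
    exact ⟨1, -q ^ k, by push_cast; ring⟩
  rw [cyclotomicCoset, hord, Finset.card_image_of_injOn, Finset.card_range]
  have aux : ∀ a b, a < b → b < 2 * m →
      δ * q ^ a % (q ^ m + 1) ≠ δ * q ^ b % (q ^ m + 1) := by
    intro a b hab hb heq
    refine key (b - a) (by omega) (by omega) ?_
    have h1 : ((q ^ m + 1 : ℕ) : ℤ) ∣ ((δ * q ^ b : ℕ) : ℤ) - (δ * q ^ a : ℕ) :=
      (Nat.modEq_iff_dvd).mp heq
    have hp : (q : ℤ) ^ b = q ^ a * q ^ (b - a) := by rw [← pow_add]; congr 1; omega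
    refine (hcop.pow_right (n := a)).dvd_of_dvd_mul_left ?_
    refine h1.trans (Eq.dvd ?_)
    push_cast
    rw [hp]
    ring
  intro a ha b hb heq
  simp only [Finset.coe_range, Set.mem_Iio] at ha hb
  rcases lt_trichotomy a b with h | h | h
  · exact absurd heq (aux a b h hb)
  · exact h
  · exact absurd heq.symm (aux b a h ha)

/-! ### Assembly of the four largest leaders -/

theorem sq_add_one_dvd_pow_add_one (q : ℤ) {k : ℕ} (hk : Odd k) :
    q ^ 2 + 1 ∣ q ^ (2 * k) + 1 := by
  have := hk.add_dvd_pow_add_pow (q ^ 2) 1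
  rwa [one_pow, ← pow_mul] at this

/-- The fourth smallest orbit maximum is attained only at the times divisible by `m = 4 * j + 6`. -/
theorem fourth_orbit_all {q N E₃ E₄ : ℤ} {j : ℕ} (hq : 3 ≤ q)
    (hN : (q ^ 2 + 1) * N = q ^ (4 * j + 6) + 1)
    (hE₃ : (q ^ 2 + 1) * E₃ = (q - 1) ^ 2 * (q ^ (4 * j + 2) + 1))
    (hE₄ : E₄ = E₃ + if j = 0 then q * (q - 1) ^ 2 else (q - 1) ^ 2 * (q ^ 2 - 1)) :
    2 * (q * N + E₄) < q ^ (4 * j + 6) + 1 ∧ ∀ t : ℕ, 0 < t → t < 4 * j + 6 →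
      ∃ z : ℤ, q ^ (4 * j + 6) + 1 ∣ z - q ^ t * (q * N + E₄) ∧ |z| < q * N + E₄ := by
  have hc : 0 < q ^ 2 + 1 := by positivity
  rcases j with _ | i
  · have h1 : q * N + E₄ = q ^ 5 - q ^ 2 + 1 := by
      refine mul_left_cancel₀ hc.ne' ?_
      rw [hE₄, if_pos rfl]
      linear_combination q * hN + hE₃
    rw [h1]
    refine ⟨?_, fun t ht0 ht => by simpa using fourth_orbit_six hq ht0 (by simpa using ht)⟩
    have h2 : 0 ≤ q ^ 5 * (q - 3) := mul_nonneg (by positivity) (by linarith)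
    have h3 : 0 < q ^ 5 := by positivity
    have h4 : 9 ≤ q ^ 2 := by nlinarith
    rw [mul_zero, zero_add]
    linarith
  · have hE : (q ^ 2 + 1) * E₄ = (q - 1) ^ 2 * (q ^ (4 * (i + 1) + 2) + q ^ 4) := by
      rw [hE₄, if_neg (by omega)]
      linear_combination hE₃
    refine ⟨?_, fun t ht0 ht => hN ▸ fourth_orbit hq hN hE ht0 ht⟩
    have hEN : E₄ < N := by
      refine lt_of_mul_lt_mul_left (a := q ^ 2 + 1) ?_ hc.le
      rw [hE, hN]
      have h1 : q ^ 4 ≤ q ^ (4 * (i + 1) + 2) := pow_le_pow_right₀ (by linarith) (by omega)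
      have h2 : (q - 1) ^ 2 * (q ^ (4 * (i + 1) + 2) + q ^ 4) ≤
          q ^ 2 * (q ^ (4 * (i + 1) + 2) + q ^ (4 * (i + 1) + 2)) :=
        mul_le_mul (by nlinarith) (by linarith) (by positivity) (by positivity)
      have h3 : q ^ (4 * (i + 1) + 6) = q ^ 2 * (q ^ 2 * q ^ (4 * (i + 1) + 2)) := by ring
      have h4 : q ^ 2 * (2 * q ^ (4 * (i + 1) + 2)) ≤ q ^ 2 * (q ^ 2 * q ^ (4 * (i + 1) + 2)) := by
        refine mul_le_mul_of_nonneg_left (mul_le_mul_of_nonneg_right ?_ ?_) ?_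
        · nlinarith
        · positivity
        · positivity
      linarith
    have hN0 : 0 < N := pos_of_mul_pos_right (hN ▸ by positivity) hc.le
    have h5 : 2 * N ≤ (q - 1) ^ 2 * N := mul_le_mul_of_nonneg_right (by nlinarith) hN0.le
    rw [← hN]
    linarith

theorem lemma10 (q m : ℕ) (hq : IsPrimePow q) (hodd : Odd q) (hm : m ≡ 2 [MOD 4]) (hm6 : 6 ≤ m) :
    ∃ δ₃ δ₄ : ℕ,
      (δ₃ : ℚ) = ((q : ℚ) - 1) ^ 2 * ((q : ℚ) ^ m - 2 * (q : ℚ) ^ (m - 4) - 1) /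
        (2 * ((q : ℚ) ^ 2 + 1)) ∧
      (δ₄ : ℚ) = (if m = 6 then (δ₃ : ℚ) - (q : ℚ) * ((q : ℚ) - 1) ^ 2
        else (δ₃ : ℚ) - ((q : ℚ) - 1) ^ 2 * ((q : ℚ) ^ 2 - 1)) ∧
      IsNthLargest (minRep q (q ^ m + 1)) 3 δ₃ ∧
      IsNthLargest (minRep q (q ^ m + 1)) 4 δ₄ ∧
      (cyclotomicCoset q (q ^ m + 1) δ₃).card = 2 * m ∧
      (cyclotomicCoset q (q ^ m + 1) δ₄).card = 2 * m := by
  obtain ⟨j, rfl⟩ : ∃ j, m = 4 * j + 6 := ⟨(m - 6) / 4, by unfold Nat.ModEq at hm; omega⟩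
  have hq3 : 3 ≤ q := by
    have := hq.two_le
    obtain ⟨k, hk⟩ := hodd
    omega
  have hq3' : (3 : ℤ) ≤ q := by exact_mod_cast hq3
  have hm0 : 0 < 4 * j + 6 := by omega
  obtain ⟨h, hh⟩ : ∃ h, q ^ (4 * j + 6) + 1 = 2 * h :=
    hodd.pow.add_one.two_dvd
  have hh' : (q : ℤ) ^ (4 * j + 6) + 1 = 2 * h := by exact_mod_cast hh
  -- Both m/2 and (m-4)/2 are odd, so q² + 1 divides q^m + 1 and q^(m-4) + 1. The second
  -- divisibility makes E₃ an integer.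
  obtain ⟨N, hN⟩ := sq_add_one_dvd_pow_add_one q (k := 2 * j + 3) ⟨j + 1, by ring⟩
  rw [show 2 * (2 * j + 3) = 4 * j + 6 by ring] at hN
  obtain ⟨L, hL⟩ := sq_add_one_dvd_pow_add_one q (k := 2 * j + 1) ⟨j, by ring⟩
  rw [show 2 * (2 * j + 1) = 4 * j + 2 by ring] at hL
  obtain ⟨E₃, hE₃⟩ : ∃ E₃ : ℤ,
      ((q : ℤ) ^ 2 + 1) * E₃ = ((q : ℤ) - 1) ^ 2 * ((q : ℤ) ^ (4 * j + 2) + 1) :=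
    ⟨((q : ℤ) - 1) ^ 2 * L, by rw [hL]; ring⟩
  obtain ⟨E₄, hE₄⟩ : ∃ E₄ : ℤ, E₄ = E₃ + if j = 0 then (q : ℤ) * ((q : ℤ) - 1) ^ 2
      else ((q : ℤ) - 1) ^ 2 * ((q : ℤ) ^ 2 - 1) := ⟨_, rfl⟩
  have hc : 0 < (q : ℤ) ^ 2 + 1 := by positivity
  have hq1 : 0 < (q : ℤ) - 1 := by linarith
  have hN0 : 0 < N := pos_of_mul_pos_right (hN ▸ by positivity) hc.le
  have hE₃0 : 0 < E₃ := pos_of_mul_pos_right (hE₃ ▸ by positivity) hc.le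
  have hqN : 0 < (q : ℤ) * N := by positivity
  have hE₃₄ : E₃ < E₄ := by
    have h1 : 0 < (q : ℤ) ^ 2 - 1 := by nlinarith
    rw [hE₄]
    split_ifs
    · have : 0 < (q : ℤ) * ((q : ℤ) - 1) ^ 2 := by positivity
      linarith
    · have : 0 < ((q : ℤ) - 1) ^ 2 * ((q : ℤ) ^ 2 - 1) := by positivity
      linarith
  obtain ⟨hlt₄, horb₄⟩ := fourth_orbit_all hq3' hN.symm hE₃ hE₄
  rw [hh'] at hlt₄
  obtain ⟨δ₂, hδ₂⟩ := Int.eq_ofNat_of_zero_le (a := h - q * N) (by linarith)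
  obtain ⟨δ₃, hδ₃⟩ := Int.eq_ofNat_of_zero_le (a := h - (q * N + E₃)) (by linarith)
  obtain ⟨δ₄, hδ₄⟩ := Int.eq_ofNat_of_zero_le (a := h - (q * N + E₄)) (by linarith)
  have hncast : ((q ^ (4 * j + 6) + 1 : ℕ) : ℤ) = (q : ℤ) ^ (4 * j + 6) + 1 := by push_cast; rfl
  have horb₃ : ∀ t : ℕ, 0 < t → t < 4 * j + 6 → ∃ z : ℤ,
      ((q ^ (4 * j + 6) + 1 : ℕ) : ℤ) ∣ z - (q : ℤ) ^ t * (q * N + E₃) ∧ |z| < q * N + E₃ := by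
    intro t ht0 ht
    rw [hncast, hN]
    exact third_orbit hq3' hN.symm hE₃ ht0 ht
  rw [← hncast] at horb₄
  have mem₁ : h ∈ minRep q (q ^ (4 * j + 6) + 1) :=
    mem_minRep_of_orbit (M := 0) hodd hm0 hh (by simp) fun t => ⟨0, by simp, by simp⟩
  have mem₂ : δ₂ ∈ minRep q (q ^ (4 * j + 6) + 1) :=
    mem_minRep_of_orbit hodd hm0 hh hδ₂.symm fun t => by
      rw [hncast, hN]
      exact second_orbit hq3' hN0 t
  have mem₃ : δ₃ ∈ minRep q (q ^ (4 * j + 6) + 1) :=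
    mem_minRep_of_orbit hodd hm0 hh hδ₃.symm (orbit_le_of_lt hm0 (by linarith) horb₃)
  have mem₄ : δ₄ ∈ minRep q (q ^ (4 * j + 6) + 1) :=
    mem_minRep_of_orbit hodd hm0 hh hδ₄.symm (orbit_le_of_lt hm0 (by linarith) horb₄)
  have lt₁ : δ₂ < h := by zify; linarith
  have lt₂ : δ₃ < δ₂ := by zify; linarith
  have lt₃ : δ₄ < δ₃ := by zify; linarith
  have pos₄ : 0 < δ₄ := by zify; linarith
  -- A leader b > δ₄ has orbit maximum h - b < qN + E₄, so only the three smaller maxima remain.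
  have classify : ∀ b ∈ minRep q (q ^ (4 * j + 6) + 1), δ₄ < b → b = h ∨ b = δ₂ ∨ b = δ₃ := by
    intro b hb hlt
    obtain ⟨hbh, horb⟩ := orbitBounded_of_mem_minRep hodd hm0 hh hb (by omega)
    have hlt' : (δ₄ : ℤ) < b := by exact_mod_cast hlt
    have hbh' : (b : ℤ) ≤ h := by exact_mod_cast hbh
    rcases horb.eq_of_lt hq3' hN.symm hE₃ (by linarith) (by rw [add_assoc, ← hE₄]; linarith)
      with h1 | h1 | h1
    · left; zify; linarith
    · right; left; zify; linarith
    · right; right; zify; linarith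
  have filter₃ : (minRep q (q ^ (4 * j + 6) + 1)).filter (δ₃ < ·) = {h, δ₂} := by
    ext b
    simp only [Finset.mem_filter, Finset.mem_insert, Finset.mem_singleton]
    constructor
    · rintro ⟨hb, hlt⟩
      rcases classify b hb (by omega) with h1 | h1 | h1 <;> omega
    · rintro (rfl | rfl)
      · exact ⟨mem₁, by omega⟩
      · exact ⟨mem₂, by omega⟩
  have filter₄ : (minRep q (q ^ (4 * j + 6) + 1)).filter (δ₄ < ·) = {h, δ₂, δ₃} := by
    ext b
    simp only [Finset.mem_filter, Finset.mem_insert, Finset.mem_singleton]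
    constructor
    · rintro ⟨hb, hlt⟩
      exact classify b hb hlt
    · rintro (rfl | rfl | rfl)
      · exact ⟨mem₁, by omega⟩
      · exact ⟨mem₂, by omega⟩
      · exact ⟨mem₃, by omega⟩
  refine ⟨δ₃, δ₄, ?_, ?_, ⟨mem₃, ?_⟩, ⟨mem₄, ?_⟩, ?_, ?_⟩
  · have e1 : ((h : ℚ)) - (q * N + E₃) = δ₃ := by exact_mod_cast hδ₃
    have e2 : (q : ℚ) ^ (4 * j + 6) + 1 = 2 * h := by exact_mod_cast hh'
    have e3 : (q : ℚ) ^ (4 * j + 6) + 1 = ((q : ℚ) ^ 2 + 1) * N := by exact_mod_cast hN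
    have e4 : ((q : ℚ) ^ 2 + 1) * E₃ = ((q : ℚ) - 1) ^ 2 * ((q : ℚ) ^ (4 * j + 2) + 1) := by
      exact_mod_cast hE₃
    rw [show 4 * j + 6 - 4 = 4 * j + 2 by omega, eq_div_iff (by positivity), ← e1]
    linear_combination (-((q : ℚ) ^ 2 + 1)) * e2 + 2 * q * e3 - 2 * e4
  · have e1 : (δ₄ : ℤ) = δ₃ - (E₄ - E₃) := by linarith
    rw [hE₄] at e1
    by_cases hj : j = 0
    · rw [if_pos (by omega)]
      rw [if_pos hj] at e1
      have : (δ₄ : ℤ) = δ₃ - q * ((q : ℤ) - 1) ^ 2 := by linarith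
      exact_mod_cast this
    · rw [if_neg (by omega)]
      rw [if_neg hj] at e1
      have : (δ₄ : ℤ) = δ₃ - ((q : ℤ) - 1) ^ 2 * ((q : ℤ) ^ 2 - 1) := by linarith
      exact_mod_cast this
  · rw [filter₃, Finset.card_pair lt₁.ne']
  · rw [filter₄, Finset.card_eq_three.mpr ⟨h, δ₂, δ₃, lt₁.ne', (lt₂.trans lt₁).ne', lt₂.ne', rfl⟩]
  · exact card_cyclotomicCoset hodd hm0 hh hδ₃.symm (by omega) (by linarith) horb₃
  · exact card_cyclotomicCoset hodd hm0 hh hδ₄.symm pos₄ (by linarith) horb₄
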